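/- Let $U(L(sl_2))$ be the universal enveloping algebra over $\mathbb C$ of the loop algebra $\mathbb C[t,t^{-1}]\otimes sl_2$, with generators $x_k^{+}=t^k\otimes e$, $x_k^{-}=t^k\otimes f$, $h_k=t^k\otimes h$ ($k\in\mathbb Z$). These satisfy $[h_j,x_k^{\pm}]=\pm 2x_{j+k}^{\pm}$, $[x_j^+,x_k^-]=h_{j+k}$, $[h_j,h_k]=0$, $[x_j^\pm,x_k^\pm]=0$. Let $U(B)$ be the subalgebra generated by $h_0$, $x_0^+$, $x_1^-$; it contains $h_k$, $x_k^+$ for $k\ge 0$ and $x_k^-$ for $k\ge 1$. Let $V_B=U(B)\Psi$ be a finite-dimensional $U(B)$-module generated by a highest weight vector $\Psi$, i.e. $\Psi\neq 0$, $x_k^+\Psi=0$ and $h_k\Psi=d_k\Psi$ with $d_k\in\mathbb C$ for all $k\ge 0$. Suppose that $x_1^-$ is nilpotent of degree $r$ in $V_B$, i.e. $(x_1^-)^{r+1}\Psi=0$ and $(x_1^-)^j\Psi\ne 0$ for $0<j\le r$. For $k\ge 0$ let $\lambda_k$ be the eigenvalue defined by $\frac{(x_0^+)^k}{k!}\frac{(x_1^-)^k}{k!}\Psi=\lambda_k\Psi$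 (a highest weight vector is always an eigenvector of these operators), and put $P_\Psi(u)=\sum_{k=0}^r\lambda_k(-u)^k$. Suppose that $$P_\Psi(u)=\prod_{j=1}^s(1-a_ju)^{m_j}$$ with distinct evaluation parameters $a_1,\dots,a_s\in\mathbb C$ and multiplicities $m_j\ge 1$, and that the evaluation parameters are nonzero: $a_1a_2\cdots a_s\neq 0$. For a collection $A=\{\alpha_1,\dots,\alpha_m\}$ of $m$ parameters put $$x_m^-(A)=\sum_{k=0}^m(-1)^k\,x_{m-k}^-\sum_{1\le i_1<\cdots<i_k\le m}\alpha_{i_1}\cdots\alpha_{i_k};$$ if $0\in A$, the coefficient of $x_0^-$ vanishes and $x_m^-(A)\in U(B)$. Let $\boldsymbol a^{(1)}=\{a_1,\dots,a_s,0\}$. Then $V_B$ is irreducible as a $U(B)$-module if and only if $$x_{s+1}^-(\boldsymbol a^{(1)})\,\Psi=0 .$$ -/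

import Mathlib

noncomputable section

namespace LoopSL2

open scoped TensorProduct
open LieAlgebra LieAlgebra.SpecialLinear

attribute [local instance 100] LieRing.ofAssociativeRing

/-- The loop algebra `ℂ[t, t⁻¹] ⊗ sl₂(ℂ)`. -/
abbrev L : Type := loopAlgebra ℂ ℤ (sl (Fin 2) ℂ)

/-- The universal enveloping algebra `U(L(sl₂))`. -/
abbrev U : Type := UniversalEnvelopingAlgebra ℂ L

/-- The matrix `e = E₁₂` of `sl₂`. -/
def e : sl (Fin 2) ℂ := single 0 1 (by decide) 1

/-- The matrix `f = E₂₁` of `sl₂`. -/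
def f : sl (Fin 2) ℂ := single 1 0 (by decide) 1

/-- The matrix `h = E₁₁ - E₂₂` of `sl₂`. -/
def h : sl (Fin 2) ℂ := singleSubSingle 0 1 1

/-- The image in `U(L(sl₂))` of the loop `t ^ k ⊗ y`. -/
def gen (k : ℤ) (y : sl (Fin 2) ℂ) : U :=
  UniversalEnvelopingAlgebra.ι ℂ ((AddMonoidAlgebra.single k (1 : ℂ)) ⊗ₜ[ℂ] y : L)

/-- The generator `x_k^+`, for `k ∈ ℤ`. -/
def xPlus (k : ℤ) : U := gen k e

/-- The generator `x_k^-`, for `k ∈ ℤ`. -/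
def xMinus (k : ℤ) : U := gen k f

/-- The generator `h_k`, for `k ∈ ℤ`. -/
def hGen (k : ℤ) : U := gen k h

lemma lie_e_f : ⁅e, f⁆ = h := by
  ext i j
  fin_cases i <;> fin_cases j <;>
    simp [e, f, h, LieRing.of_associative_ring_bracket]

lemma lie_h_e : ⁅h, e⁆ = (2 : ℂ) • e := by
  ext i j
  fin_cases i <;> fin_cases j <;>
    simp [e, h, LieRing.of_associative_ring_bracket, Matrix.mul_apply, Matrix.single_apply] <;> norm_num

lemma lie_h_f : ⁅h, f⁆ = (-2 : ℂ) • f := by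
  ext i j
  fin_cases i <;> fin_cases j <;>
    simp [f, h, LieRing.of_associative_ring_bracket, Matrix.mul_apply, Matrix.single_apply] <;> norm_num

lemma gen_commutator (j k : ℤ) (y z : sl (Fin 2) ℂ) :
    gen j y * gen k z - gen k z * gen j y = gen (j + k) ⁅y, z⁆ := by
  unfold gen
  rw [← LieRing.of_associative_ring_bracket, ← LieHom.map_lie,
    LieAlgebra.ExtendScalars.bracket_tmul, AddMonoidAlgebra.single_mul_single, mul_one]

lemma gen_smul (k : ℤ) (c : ℂ) (y : sl (Fin 2) ℂ) : gen k (c • y) = c • gen k y := by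
  unfold gen
  rw [TensorProduct.tmul_smul, map_smul]

/-- The defining relation `[x_j^+, x_k^-] = h_{j+k}`. -/
lemma xPlus_xMinus (j k : ℤ) :
    xPlus j * xMinus k - xMinus k * xPlus j = hGen (j + k) := by
  simp only [xPlus, xMinus, hGen, gen_commutator, lie_e_f]

/-- The defining relation `[h_j, x_k^+] = 2 x_{j+k}^+`. -/
lemma hGen_xPlus (j k : ℤ) :
    hGen j * xPlus k - xPlus k * hGen j = (2 : ℂ) • xPlus (j + k) := by
  simp only [xPlus, hGen, gen_commutator, lie_h_e, gen_smul]

/-- The defining relation `[h_j, x_k^-] = -2 x_{j+k}^-`. -/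
lemma hGen_xMinus (j k : ℤ) :
    hGen j * xMinus k - xMinus k * hGen j = (-2 : ℂ) • xMinus (j + k) := by
  simp only [xMinus, hGen, gen_commutator, lie_h_f, gen_smul]

/-- The Borel subalgebra `U(B)` of `U(L(sl₂))`: the unital associative subalgebra generated by
`h_0`, `x_0^+` and `x_1^-`. -/
def UB : Subalgebra ℂ U := Algebra.adjoin ℂ {hGen 0, xPlus 0, xMinus 1}

lemma hGen_zero_mem : hGen 0 ∈ UB := Algebra.subset_adjoin (by simp)

lemma xPlus_zero_mem : xPlus 0 ∈ UB := Algebra.subset_adjoin (by simp)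

lemma xMinus_one_mem : xMinus 1 ∈ UB := Algebra.subset_adjoin (by simp)

lemma hGen_one_mem : hGen 1 ∈ UB := by
  have := xPlus_xMinus 0 1
  rw [zero_add] at this
  rw [← this]
  exact UB.sub_mem (UB.mul_mem xPlus_zero_mem xMinus_one_mem)
    (UB.mul_mem xMinus_one_mem xPlus_zero_mem)

lemma xPlus_mem (k : ℕ) : xPlus k ∈ UB := by
  induction k with
  | zero => simpa using xPlus_zero_mem
  | succ k ih =>
    have h1 : xPlus ((k + 1 : ℕ) : ℤ)
        = (2 : ℂ)⁻¹ • (hGen 1 * xPlus k - xPlus k * hGen 1) := by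
      rw [hGen_xPlus, smul_smul, inv_mul_cancel₀ two_ne_zero, one_smul]
      congr 1
      push_cast
      ring
    rw [h1]
    exact UB.smul_mem (UB.sub_mem (UB.mul_mem hGen_one_mem ih) (UB.mul_mem ih hGen_one_mem)) _

lemma xMinus_mem (k : ℕ) (hk : 0 < k) : xMinus k ∈ UB := by
  induction k, hk using Nat.le_induction with
  | base => simpa using xMinus_one_mem
  | succ k _ ih =>
    have h1 : xMinus ((k + 1 : ℕ) : ℤ)
        = (-2 : ℂ)⁻¹ • (hGen 1 * xMinus k - xMinus k * hGen 1) := by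
      rw [hGen_xMinus, smul_smul, inv_mul_cancel₀ (by norm_num), one_smul]
      congr 1
      push_cast
      ring
    rw [h1]
    exact UB.smul_mem (UB.sub_mem (UB.mul_mem hGen_one_mem ih) (UB.mul_mem ih hGen_one_mem)) _

lemma hGen_mem (k : ℕ) : hGen k ∈ UB := by
  rcases k with _ | k
  · simpa using hGen_zero_mem
  · have h1 := xPlus_xMinus k 1
    push_cast
    rw [← h1]
    exact UB.sub_mem (UB.mul_mem (xPlus_mem k) xMinus_one_mem)
      (UB.mul_mem xMinus_one_mem (xPlus_mem k))

/-- `x_k^+ ∈ U(B)` for `k ≥ 0`. -/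
def xP (k : ℕ) : UB := ⟨xPlus k, xPlus_mem k⟩

/-- `h_k ∈ U(B)` for `k ≥ 0`. -/
def hB (k : ℕ) : UB := ⟨hGen k, hGen_mem k⟩

/-- `xMsucc k` is `x_{k+1}^- ∈ U(B)`, for `k ≥ 0`. -/
def xMsucc (k : ℕ) : UB := ⟨xMinus (k + 1 : ℕ), xMinus_mem (k + 1) k.succ_pos⟩

/-- The generator with parameters
`x_m^-(A) = ∑_{k=0}^m (-1)^k e_k(A) x_{m-k}^-`, where `A` is a collection of `m` parameters
(with multiplicity) and `e_k` is the elementary symmetric polynomial. -/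
def xMinusParam (A : Multiset ℂ) : U :=
  ∑ k ∈ Finset.range (A.card + 1), ((-1 : ℂ) ^ k * A.esymm k) • xMinus ((A.card : ℤ) - k)

lemma xMinusParam_mem (A : Multiset ℂ) (hA : (0 : ℂ) ∈ A) : xMinusParam A ∈ UB := by
  unfold xMinusParam
  refine UB.sum_mem fun k hk => ?_
  rcases Nat.lt_or_ge k A.card with hlt | hge
  · have h1 : ((A.card : ℤ) - k) = ((A.card - k : ℕ) : ℤ) := by omega
    rw [h1]
    exact UB.smul_mem (xMinus_mem _ (by omega)) _
  · have h1 : k = A.card := by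
      have := Finset.mem_range.mp hk
      omega
    have h2 : A.esymm k = 0 := by
      rw [h1, Multiset.esymm, Multiset.powersetCard_self]
      simpa using Multiset.prod_eq_zero hA
    rw [h2]
    simp

/-- For a collection `a` of `s` parameters, the element `x_{s+1}^-(a^{(1)})` of `U(B)`, where
`a^{(1)} = a ∪ {0}`. -/
def xMinusExt (a : Multiset ℂ) : UB :=
  ⟨xMinusParam (0 ::ₘ a), xMinusParam_mem _ (Multiset.mem_cons_self 0 a)⟩

section Modules

variable {V : Type*} [AddCommGroup V] [Module ℂ V] [Module UB V] [IsScalarTower ℂ UB V]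

/-- `Ψ` is a highest weight vector of `U(B)` with highest weight `(d_k)_{k ≥ 0}`. -/
structure IsHighestWeightVector (d : ℕ → ℂ) (Ψ : V) : Prop where
  ne_zero : Ψ ≠ 0
  xP_smul : ∀ k : ℕ, xP k • Ψ = 0
  hB_smul : ∀ k : ℕ, hB k • Ψ = d k • Ψ

/-- `x_1^-` is nilpotent of degree `r` (on the module generated by `Ψ`). -/
def IsNilpotentOfDegree (r : ℕ) (Ψ : V) : Prop :=
  (xMsucc 0) ^ (r + 1) • Ψ = 0 ∧ ∀ j : ℕ, 0 < j → j ≤ r → (xMsucc 0) ^ j • Ψ ≠ 0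

/-- The operator `(x_0^+)^{(k)} (x_1^-)^{(k)}`, with divided powers `X^{(k)} = X^k / k!`. -/
def dividedProduct (k : ℕ) : UB :=
  ((k.factorial : ℂ)⁻¹ • xP 0 ^ k) * ((k.factorial : ℂ)⁻¹ • xMsucc 0 ^ k)

open Classical in
/-- The eigenvalue `λ_k` of `(x_0^+)^{(k)} (x_1^-)^{(k)}` on `Ψ`. It exists for every highest
weight vector, see `dividedProduct_smul`, and is unique since `Ψ ≠ 0`. -/
def eigenvalue (k : ℕ) (Ψ : V) : ℂ :=
  if hc : ∃ c : ℂ, dividedProduct k • Ψ = c • Ψ then hc.choose else 0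

/-- The span of the vectors `x_{j_1}^- ⋯ x_{j_n}^- Ψ`. -/
def sector (Ψ : V) : ℕ → Submodule ℂ V
  | 0 => Submodule.span ℂ {Ψ}
  | n + 1 => Submodule.span ℂ {w | ∃ k : ℕ, ∃ v ∈ sector Ψ n, w = xMsucc k • v}

lemma hB_mem_sector {d : ℕ → ℂ} {Ψ : V} (hΨ : IsHighestWeightVector d Ψ) (n j : ℕ) {v : V}
    (hv : v ∈ sector Ψ n) : hB j • v ∈ sector Ψ n := by
  induction n generalizing j v with
  | zero =>
    obtain ⟨c, rfl⟩ := Submodule.mem_span_singleton.mp hv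
    rw [smul_algebra_smul_comm, hΨ.hB_smul]
    exact Submodule.smul_mem _ _ (Submodule.smul_mem _ _ (Submodule.mem_span_singleton_self Ψ))
  | succ n ih =>
    refine Submodule.span_induction ?_ ?_ ?_ ?_ hv
    · rintro w ⟨k, v, hv, rfl⟩
      have hc : hB j * xMsucc k = xMsucc k * hB j + (-2 : ℂ) • xMsucc (j + k) := by
        apply Subtype.ext
        have h1 := hGen_xMinus j (k + 1 : ℕ)
        have h2 : ((j + k + 1 : ℕ) : ℤ) = (j : ℤ) + (k + 1 : ℕ) := by push_cast; ring
        change hGen j * xMinus (k + 1 : ℕ) =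
          xMinus (k + 1 : ℕ) * hGen j + (-2 : ℂ) • xMinus (j + k + 1 : ℕ)
        rw [h2, ← h1]
        abel
      rw [← mul_smul, hc, add_smul, mul_smul, smul_assoc]
      exact Submodule.add_mem _ (Submodule.subset_span ⟨k, _, ih j hv, rfl⟩)
        (Submodule.smul_mem _ _ (Submodule.subset_span ⟨j + k, v, hv, rfl⟩))
    · rw [smul_zero]
      exact Submodule.zero_mem _
    · intro x y _ _ hx hy
      rw [smul_add]
      exact Submodule.add_mem _ hx hy
    · intro c x _ hx
      rw [smul_algebra_smul_comm]
      exact Submodule.smul_mem _ _ hx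

lemma xP_mem_sector {d : ℕ → ℂ} {Ψ : V} (hΨ : IsHighestWeightVector d Ψ) (n j : ℕ) {v : V}
    (hv : v ∈ sector Ψ (n + 1)) : xP j • v ∈ sector Ψ n := by
  have hc : ∀ k, xP j * xMsucc k = xMsucc k * xP j + hB (j + k + 1) := fun k => by
    apply Subtype.ext
    have h1 := xPlus_xMinus j (k + 1 : ℕ)
    have h2 : ((j + k + 1 : ℕ) : ℤ) = (j : ℤ) + (k + 1 : ℕ) := by push_cast; ring
    change xPlus j * xMinus (k + 1 : ℕ) = xMinus (k + 1 : ℕ) * xPlus j + hGen (j + k + 1 : ℕ)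
    rw [h2, ← h1]
    abel
  induction n generalizing v with
  | zero =>
    refine Submodule.span_induction ?_ ?_ ?_ ?_ hv
    · rintro w ⟨k, v, hv, rfl⟩
      rw [← mul_smul, hc, add_smul, mul_smul]
      have h0 : xP j • v = 0 := by
        obtain ⟨c, rfl⟩ := Submodule.mem_span_singleton.mp hv
        rw [smul_algebra_smul_comm, hΨ.xP_smul, smul_zero]
      rw [h0, smul_zero, zero_add]
      exact hB_mem_sector hΨ 0 _ hv
    · rw [smul_zero]
      exact Submodule.zero_mem _
    · intro x y _ _ hx hy
      rw [smul_add]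
      exact Submodule.add_mem _ hx hy
    · intro c x _ hx
      rw [smul_algebra_smul_comm]
      exact Submodule.smul_mem _ _ hx
  | succ n ih =>
    refine Submodule.span_induction ?_ ?_ ?_ ?_ hv
    · rintro w ⟨k, v, hv, rfl⟩
      rw [← mul_smul, hc, add_smul, mul_smul]
      exact Submodule.add_mem _ (Submodule.subset_span ⟨k, _, ih hv, rfl⟩)
        (hB_mem_sector hΨ _ _ hv)
    · rw [smul_zero]
      exact Submodule.zero_mem _
    · intro x y _ _ hx hy
      rw [smul_add]
      exact Submodule.add_mem _ hx hy
    · intro c x _ hx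
      rw [smul_algebra_smul_comm]
      exact Submodule.smul_mem _ _ hx

/-- A highest weight vector is an eigenvector of every `(x_0^+)^{(k)} (x_1^-)^{(k)}`, and
`eigenvalue k Ψ` is the eigenvalue. -/
lemma dividedProduct_smul {d : ℕ → ℂ} {Ψ : V} (hΨ : IsHighestWeightVector d Ψ) (k : ℕ) :
    dividedProduct k • Ψ = eigenvalue k Ψ • Ψ := by
  have hx : ∀ n, (xMsucc 0) ^ n • Ψ ∈ sector Ψ n := fun n => by
    induction n with
    | zero =>
      rw [pow_zero, one_smul]
      exact Submodule.mem_span_singleton_self Ψ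
    | succ n ih =>
      rw [pow_succ', mul_smul]
      exact Submodule.subset_span ⟨0, _, ih, rfl⟩
  have hy : ∀ n, ∀ v ∈ sector Ψ n, (xP 0) ^ n • v ∈ sector Ψ 0 := fun n => by
    induction n with
    | zero =>
      intro v hv
      rwa [pow_zero, one_smul]
    | succ n ih =>
      intro v hv
      rw [pow_succ, mul_smul]
      exact ih _ (xP_mem_sector hΨ n 0 hv)
  obtain ⟨c, hc⟩ := Submodule.mem_span_singleton.mp (hy k _ (hx k))
  have hex : ∃ c : ℂ, dividedProduct k • Ψ = c • Ψ := by
    refine ⟨(k.factorial : ℂ)⁻¹ * ((k.factorial : ℂ)⁻¹ * c), ?_⟩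
    rw [dividedProduct, mul_smul, smul_assoc, smul_assoc, smul_algebra_smul_comm, ← hc,
      smul_smul, smul_smul, mul_assoc]
  rw [eigenvalue, dif_pos hex]
  exact hex.choose_spec

/-- The generalized Drinfeld polynomial `P_Ψ(u) = ∑_{k=0}^r λ_k (-u)^k`. -/
def drinfeldPoly (r : ℕ) (Ψ : V) : Polynomial ℂ :=
  ∑ k ∈ Finset.range (r + 1), Polynomial.C (eigenvalue k Ψ) * (-Polynomial.X) ^ k

/-- `a_1, …, a_s` are the evaluation parameters of `Ψ`, with multiplicities `m_1, …, m_s`: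
they are distinct, the multiplicities are positive, and
`P_Ψ(u) = ∏_{j=1}^s (1 - a_j u)^{m_j}`. -/
structure IsEvaluationParameters (r : ℕ) (Ψ : V) {s : ℕ} (a : Fin s → ℂ) (m : Fin s → ℕ) :
    Prop where
  distinct : Function.Injective a
  mult_pos : ∀ j, 0 < m j
  factorization : drinfeldPoly r Ψ =
    ∏ j, (1 - Polynomial.C (a j) * Polynomial.X) ^ m j

end Modules

end LoopSL2

end

/-! Let `Q = ∏ (t - a_i)`. The element in the criterion is `x^-(t Q)`, written `lowerOp Q`, because
the extra parameter 0 contributes the factor `t`.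

If `V` is simple, put `w = x^-(t Q) Ψ`, a vector of `h_0`-weight `d_0 - 2`. Then `x_k^+ w =
h(t^{k+1} Q) Ψ`, so `w` is singular once the functional `t^{k+1} ↦ d_{k+1}` kills every multiple of
`t Q`. Garland's identity (`raise_pow_lower_pow`) gives this: it identifies `P_Ψ` with the power
series solving `p' = -(∑ d_{k+1} u^k) p`, and the logarithmic derivative of the factorization yields
`d_{k+1} = ∑ m_i a_i^{k+1}`. A nonzero singular vector of lower weight would generate a proper
submodule (`eq_zero_of_singular`), hence `w = 0`.

Conversely, if `x^-(t Q) Ψ = 0`, commuting with `h_k`, the `x_k^-` and `x_0^+` shows that `x^-(t p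
Q)` and `h(t p Q)` vanish on all of `V`. Thus `x^-(t p)` and `h(t p)` depend only on the values
`p(a_i)`. As the `a_i` are distinct and nonzero, Lagrange interpolation produces `s` triples
satisfying the relations of commuting `sl₂`'s that are used, and `V` is spanned by the monomials in
the `F_j` applied to `Ψ`. Finite dimension forces dominant integral weights, and a suitable product
of the `E_j` takes any nonzero vector back to `Ψ` (`exists_raise_eq`). -/

noncomputable section
namespace LoopSL2
open Module

/-! ### Commuting `sl₂`-triples acting on a highest weight vector. -/

section CommutingTriples

variable {ι V : Type*} [Fintype ι] [DecidableEq ι] [AddCommGroup V] [Module ℂ V]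

/-- The product of the powers `F i ^ n i` of commuting operators. -/
def opMonomial (F : ι → End ℂ V) (hF : Pairwise fun i j => Commute (F i) (F j)) :
    (ι → Multiplicative ℕ) →* End ℂ V :=
  MonoidHom.noncommPiCoprod (fun i => powersHom _ (F i))
    fun _ _ hij _ _ => (hF hij).pow_pow _ _

/-- The vector obtained by applying a monomial in commuting operators to `Ψ`. -/
def monomialVec (F : ι → End ℂ V) (hF : Pairwise fun i j => Commute (F i) (F j)) (Ψ : V)
    (n : ι → ℕ) : V :=
  opMonomial F hF (fun i => Multiplicative.ofAdd (n i)) Ψ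

variable {F : ι → End ℂ V} {hF : Pairwise fun i j => Commute (F i) (F j)} {Ψ : V}

lemma opMonomial_mulSingle (j : ι) (k : ℕ) :
    opMonomial F hF (fun i => Multiplicative.ofAdd ((Pi.single j k : ι → ℕ) i)) = F j ^ k := by
  have : (fun i => Multiplicative.ofAdd ((Pi.single j k : ι → ℕ) i)) =
      Pi.mulSingle j (Multiplicative.ofAdd k) := by
    ext i
    by_cases hij : i = j
    · subst hij; simp
    · simp [hij]
  rw [this]
  exact MonoidHom.noncommPiCoprod_mulSingle (fun i => powersHom (End ℂ V) (F i))
    (hcomm := fun _ _ hij _ _ => (hF hij).pow_pow _ _) j (Multiplicative.ofAdd k)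

@[simp] lemma monomialVec_zero : monomialVec F hF Ψ 0 = Ψ := by
  have : opMonomial F hF (fun i => Multiplicative.ofAdd ((0 : ι → ℕ) i)) = 1 :=
    map_one (opMonomial F hF)
  rw [monomialVec, this, End.one_apply]

lemma monomialVec_add (m n : ι → ℕ) :
    monomialVec F hF Ψ (m + n) =
      opMonomial F hF (fun i => Multiplicative.ofAdd (m i)) (monomialVec F hF Ψ n) := by
  rw [monomialVec, monomialVec, ← End.mul_apply, ← map_mul]
  rfl

lemma monomialVec_add_single (n : ι → ℕ) (j : ι) (k : ℕ) :
    monomialVec F hF Ψ (n + Pi.single j k) = (F j ^ k) (monomialVec F hF Ψ n) := by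
  rw [add_comm, monomialVec_add, opMonomial_mulSingle]

lemma monomialVec_single (j : ι) (k : ℕ) :
    monomialVec F hF Ψ (Pi.single j k) = (F j ^ k) Ψ := by
  rw [← zero_add (Pi.single j k : ι → ℕ), monomialVec_add_single, monomialVec_zero]

/-- Induction on multi-indices, adding one unit vector at a time. -/
lemma multiIndex_induction {p : (ι → ℕ) → Prop} (h0 : p 0)
    (hs : ∀ n j, p n → p (n + Pi.single j 1)) (n : ι → ℕ) : p n := by
  induction hN : ∑ i, n i generalizing n with
  | zero =>
    have : n = 0 := by
      ext i
      exact (Finset.sum_eq_zero_iff.mp hN) i (Finset.mem_univ i)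
    rwa [this]
  | succ N ih =>
    obtain ⟨j, hj⟩ : ∃ j, n j ≠ 0 := by
      by_contra! hc
      simp [hc] at hN
    have hn : n = (n - Pi.single j 1) + Pi.single j 1 := by
      ext i
      by_cases hij : i = j
      · subst hij; simp; omega
      · simp [hij]
    rw [hn]
    refine hs _ _ (ih _ ?_)
    rw [hn] at hN
    simp only [Pi.add_apply, Finset.sum_add_distrib, Finset.sum_pi_single', Finset.mem_univ,
      if_true] at hN
    omega

/-- Operators satisfying the relations of commuting `sl₂`-triples, and a common highest weight
vector. -/
structure IsCommutingTriples (E F H : ι → End ℂ V) (Ψ : V) (μ : ι → ℂ) : Prop where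
  commute_F : Pairwise fun i j => Commute (F i) (F j)
  E_F : ∀ i j v, E i (F j v) = F j (E i v) + if i = j then H i v else 0
  H_F : ∀ i j v, H i (F j v) = F j (H i v) - if i = j then (2 : ℂ) • F i v else 0
  E_vec : ∀ i, E i Ψ = 0
  H_vec : ∀ i, H i Ψ = μ i • Ψ

variable {E H : ι → End ℂ V} {μ : ι → ℂ}

namespace IsCommutingTriples

lemma H_monomialVec (T : IsCommutingTriples E F H Ψ μ) (j : ι) (n : ι → ℕ) :
    H j (monomialVec F T.commute_F Ψ n) =
      (μ j - 2 * n j) • monomialVec F T.commute_F Ψ n := by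
  induction n using multiIndex_induction with
  | h0 => simp [T.H_vec]
  | hs n i ih =>
    rw [monomialVec_add_single, pow_one, T.H_F, ih, map_smul]
    by_cases hij : j = i
    · subst hij
      simp only [if_true, ← sub_smul, Pi.add_apply, Pi.single_eq_same]
      congr 1
      push_cast
      ring
    · simp [hij]

/-- The usual `sl₂`-string computation in direction `j`, since `E j` commutes with the other `F i`.
Truncated subtraction is harmless: the coefficient vanishes when `n j = 0`. -/
lemma E_monomialVec (T : IsCommutingTriples E F H Ψ μ) (j : ι) (n : ι → ℕ) :
    E j (monomialVec F T.commute_F Ψ n) =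
      (n j * (μ j - n j + 1)) • monomialVec F T.commute_F Ψ (n - Pi.single j 1) := by
  induction n using multiIndex_induction with
  | h0 => simp [T.E_vec]
  | hs n i ih =>
    rw [monomialVec_add_single, pow_one, T.E_F, ih, map_smul]
    have hFi := fun k => monomialVec_add_single (hF := T.commute_F) (Ψ := Ψ) k i 1
    simp only [pow_one] at hFi
    rw [← hFi]
    by_cases hij : j = i
    · subst hij
      rw [if_pos rfl, T.H_monomialVec]
      have h1 : n + Pi.single j 1 - Pi.single j 1 = n := by ext k; simp
      rw [h1]
      by_cases hn : n j = 0
      · simp [hn]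
      · have h2 : n - Pi.single j 1 + Pi.single j 1 = n := by
          ext k
          by_cases hk : k = j
          · subst hk; simp; omega
          · simp [hk]
        rw [h2, ← add_smul]
        congr 1
        simp only [Pi.add_apply, Pi.single_eq_same]
        push_cast
        ring
    · have h1 : n - Pi.single j 1 + Pi.single i 1 = n + Pi.single i 1 - Pi.single j 1 := by
        ext k
        by_cases hk : k = j
        · subst hk; simp [hij]
        · simp [hk]
      simp [hij, h1]

/-- Otherwise these vectors would be infinitely many eigenvectors of `H j` with distinct eigenvalues
`μ j - 2k`. -/
lemma exists_pow_F_eq_zero [FiniteDimensional ℂ V] (T : IsCommutingTriples E F H Ψ μ) (j : ι) :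
    ∃ k, (F j ^ k) Ψ = 0 := by
  by_contra! hne
  have hli : LinearIndependent ℂ fun k : ℕ => (F j ^ k) Ψ := by
    refine End.eigenvectors_linearIndependent' (H j) (fun k : ℕ => μ j - 2 * k) ?_ _ ?_
    · intro k l hkl
      simpa using hkl
    · intro k
      refine ⟨End.mem_eigenspace_iff.mpr ?_, hne k⟩
      have := T.H_monomialVec j (Pi.single j k)
      simpa [monomialVec_single] using this
  exact not_finite_iff_infinite.mpr (inferInstance : Infinite ℕ) hli.finite

/-- At the first vanishing power `N + 1`, applying `E j` gives `(N + 1)(μ j - N) F_j^N Ψ = 0` with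
`F_j^N Ψ ≠ 0`. -/
lemma exists_nat_weight [FiniteDimensional ℂ V] (T : IsCommutingTriples E F H Ψ μ)
    (hΨ : Ψ ≠ 0) (j : ι) : ∃ N : ℕ, μ j = N ∧ (F j ^ (N + 1)) Ψ = 0 := by
  classical
  have hex := T.exists_pow_F_eq_zero j
  obtain ⟨N, hN⟩ : ∃ N, Nat.find hex = N + 1 := by
    refine Nat.exists_eq_succ_of_ne_zero fun h0 => hΨ ?_
    have := Nat.find_spec hex
    rw [h0] at this
    simpa using this
  have h1 : (F j ^ (N + 1)) Ψ = 0 := hN ▸ Nat.find_spec hex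
  have h2 : (F j ^ N) Ψ ≠ 0 := Nat.find_min hex (by omega)
  refine ⟨N, ?_, h1⟩
  have h3 := T.E_monomialVec j (Pi.single j (N + 1))
  have h4 : (Pi.single j (N + 1) - Pi.single j 1 : ι → ℕ) = Pi.single j N := by
    ext i
    by_cases hij : i = j
    · subst hij; simp
    · simp [hij]
  rw [h4, monomialVec_single, monomialVec_single, h1, map_zero, Pi.single_eq_same, eq_comm,
    smul_eq_zero_iff_left h2] at h3
  have h5 : ((N + 1 : ℕ) : ℂ) ≠ 0 := by exact_mod_cast N.succ_ne_zero
  have h6 := (mul_eq_zero.mp h3).resolve_left h5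
  push_cast at h6
  linear_combination h6

/-- A product of raising operators that sends the monomial vector of index `n` to `Ψ` and kills
the other ones of at most the same degree. -/
lemma exists_extraction (T : IsCommutingTriples E F H Ψ μ) {N : ι → ℕ}
    (hN : ∀ j, μ j = N j) (n : ι → ℕ) (hn : n ≤ N) :
    ∃ A ∈ Algebra.adjoin ℂ (Set.range E), A (monomialVec F T.commute_F Ψ n) = Ψ ∧
      ∀ k : ι → ℕ, ∑ i, k i ≤ ∑ i, n i → k ≠ n → A (monomialVec F T.commute_F Ψ k) = 0 := by
  induction n using multiIndex_induction with
  | h0 =>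
    refine ⟨1, Subalgebra.one_mem _, by simp, fun k hk hk0 => absurd ?_ hk0⟩
    ext i
    have := Finset.single_le_sum (f := k) (fun i _ => Nat.zero_le _) (Finset.mem_univ i)
    simp at hk ⊢
    exact hk i
  | hs n j ih =>
    obtain ⟨A, hA, hA1, hA2⟩ := ih (le_trans (by simp) hn)
    have hj : n j + 1 ≤ N j := by simpa using hn j
    -- `E j` sends the monomial of index `n + e_j` to `c` times that of index `n`; here `c = (n j +
    -- 1)(N j - n j)`, nonzero because `n j < N j`.
    set c : ℂ := ((n + Pi.single j 1 : ι → ℕ) j : ℂ) *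
      (μ j - (n + Pi.single j 1 : ι → ℕ) j + 1) with hc
    have hc0 : c ≠ 0 := by
      rw [hc, hN]
      simp only [Pi.add_apply, Pi.single_eq_same]
      refine mul_ne_zero (by exact_mod_cast (n j).succ_ne_zero) ?_
      have : (N j : ℂ) - ((n j + 1 : ℕ) : ℂ) + 1 = ((N j - n j : ℕ) : ℂ) := by
        rw [Nat.cast_sub (by omega)]
        push_cast
        ring
      rw [this]
      exact_mod_cast (by omega : N j - n j ≠ 0)
    refine ⟨c⁻¹ • (A * E j), Subalgebra.smul_mem _ (Subalgebra.mul_mem _ hA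
      (Algebra.subset_adjoin ⟨j, rfl⟩)) _, ?_, fun k hk hkn => ?_⟩
    · have h1 : n + Pi.single j 1 - Pi.single j 1 = n := by ext k; simp
      rw [LinearMap.smul_apply, End.mul_apply, T.E_monomialVec, h1, map_smul, hA1, ← hc,
        inv_smul_smul₀ hc0]
    · rw [LinearMap.smul_apply, End.mul_apply, T.E_monomialVec, map_smul]
      -- Either `E j` kills the monomial, or it lowers its degree by one and the induction
      -- hypothesis applies: `k - e_j = n` would give `k = n + e_j`.
      by_cases hk0 : k j = 0
      · simp [hk0]
      · have hk1 : k = (k - Pi.single j 1) + Pi.single j 1 := by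
          ext i
          by_cases hij : i = j
          · subst hij; simp; omega
          · simp [hij]
        rw [hA2, smul_zero, smul_zero]
        · rw [hk1] at hk
          simp only [Pi.add_apply, Finset.sum_add_distrib] at hk
          omega
        · intro he
          rw [he] at hk1
          exact hkn hk1

/-- A monomial with some exponent above `N j` vanishes, because commutativity lets `F_j^{N_j+1}` act
on `Ψ` first. -/
lemma mem_span_monomialVec_le (T : IsCommutingTriples E F H Ψ μ) {N : ι → ℕ}
    (hN : ∀ j, (F j ^ (N j + 1)) Ψ = 0) {w : V}
    (hw : w ∈ Submodule.span ℂ (Set.range (monomialVec F T.commute_F Ψ))) :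
    w ∈ Submodule.span ℂ (monomialVec F T.commute_F Ψ '' {n | n ≤ N}) := by
  refine Submodule.span_le.mpr ?_ hw
  rintro _ ⟨n, rfl⟩
  by_cases hn : n ≤ N
  · exact Submodule.subset_span ⟨n, hn, rfl⟩
  · obtain ⟨j, hj⟩ : ∃ j, N j < n j := by simpa [Pi.le_def] using hn
    have h1 : n = (n - Pi.single j (N j + 1)) + Pi.single j (N j + 1) := by
      ext i
      by_cases hij : i = j
      · subst hij; simp; omega
      · simp [hij]
    rw [h1, monomialVec_add, monomialVec_single, hN, map_zero]
    exact Submodule.zero_mem _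

/-- Every nonzero vector of the module generated by `Ψ` can be raised to `Ψ`. -/
theorem exists_raise_eq [FiniteDimensional ℂ V] (T : IsCommutingTriples E F H Ψ μ)
    (hΨ : Ψ ≠ 0) {w : V} (hw0 : w ≠ 0)
    (hw : w ∈ Submodule.span ℂ (Set.range (monomialVec F T.commute_F Ψ))) :
    ∃ A ∈ Algebra.adjoin ℂ (Set.range E), A w = Ψ := by
  choose N hN1 hN2 using T.exists_nat_weight hΨ
  obtain ⟨c, hc, rfl⟩ := (Finsupp.mem_span_image_iff_linearCombination ℂ).mp
    (T.mem_span_monomialVec_le hN2 hw)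
  have hc0 : c.support.Nonempty := by
    rw [Finsupp.support_nonempty_iff]
    rintro rfl
    simp at hw0
  -- An index of top degree in one chosen expansion of the vector; the monomials need not be
  -- linearly independent.
  obtain ⟨n, hn, hmax⟩ := c.support.exists_max_image (fun k => ∑ i, k i) hc0
  obtain ⟨A, hA, hA1, hA2⟩ := T.exists_extraction hN1 n (hc hn)
  have hcn : c n ≠ 0 := Finsupp.mem_support_iff.mp hn
  refine ⟨(c n)⁻¹ • A, Subalgebra.smul_mem _ hA _, ?_⟩
  rw [LinearMap.smul_apply, Finsupp.linearCombination_apply, Finsupp.sum, map_sum,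
    Finset.sum_eq_single n, map_smul, hA1, inv_smul_smul₀ hcn]
  · intro k hk hkn
    rw [map_smul, hA2 k (hmax k hk) hkn, smul_zero]
  · intro h
    exact absurd hn h

end IsCommutingTriples

end CommutingTriples

/-! ### Formal derivatives over a noncommutative ring. -/

section GeneratingSeries

variable {R : Type*} [Ring R]

/-- The formal derivative of a power series with coefficients in a possibly noncommutative
ring. -/
def formalDeriv (A : PowerSeries R) : PowerSeries R :=
  PowerSeries.mk fun n => (n + 1) • PowerSeries.coeff (n + 1) A

lemma coeff_formalDeriv (A : PowerSeries R) (n : ℕ) :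
    PowerSeries.coeff n (formalDeriv A) = (n + 1) • PowerSeries.coeff (n + 1) A :=
  PowerSeries.coeff_mk _ _

lemma formalDeriv_mul (A B : PowerSeries R) :
    formalDeriv (A * B) = formalDeriv A * B + A * formalDeriv B := by
  ext n
  rw [coeff_formalDeriv, map_add, PowerSeries.coeff_mul, PowerSeries.coeff_mul,
    PowerSeries.coeff_mul, Finset.smul_sum]
  -- Split `n + 1 = q.1 + q.2`. In each half the boundary term has coefficient 0, and an index shift
  -- leaves one derivative.
  have h1 : ∑ q ∈ Finset.HasAntidiagonal.antidiagonal (n + 1),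
      (n + 1) • (PowerSeries.coeff q.1 A * PowerSeries.coeff q.2 B) =
      ∑ q ∈ Finset.HasAntidiagonal.antidiagonal (n + 1),
        q.1 • (PowerSeries.coeff q.1 A * PowerSeries.coeff q.2 B) +
      ∑ q ∈ Finset.HasAntidiagonal.antidiagonal (n + 1),
        q.2 • (PowerSeries.coeff q.1 A * PowerSeries.coeff q.2 B) := by
    rw [← Finset.sum_add_distrib]
    refine Finset.sum_congr rfl fun q hq => ?_
    rw [← add_smul, Finset.HasAntidiagonal.mem_antidiagonal.mp hq]
  rw [h1, Finset.Nat.sum_antidiagonal_succ, Finset.Nat.sum_antidiagonal_succ' (n := n)]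
  simp only [coeff_formalDeriv, zero_smul, zero_add, smul_mul_assoc, mul_smul_comm]

end GeneratingSeries

/-! ### Garland's identity through generating series. -/

section Garland

variable {V : Type*} [AddCommGroup V] [Module ℂ V]

/-- The power series of operators whose coefficients kill `Ψ`, a left ideal. -/
def seriesAnnihilator (Ψ : V) : Submodule (PowerSeries (End ℂ V)) (PowerSeries (End ℂ V)) where
  carrier := {A | ∀ n, PowerSeries.coeff n A Ψ = 0}
  zero_mem' n := by simp
  add_mem' hA hB n := by rw [map_add, LinearMap.add_apply, hA, hB, add_zero]
  smul_mem' C A hA n := by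
    rw [smul_eq_mul, PowerSeries.coeff_mul, LinearMap.sum_apply]
    exact Finset.sum_eq_zero fun q _ => by rw [End.mul_apply, hA, map_zero]

/-- The operators of the current algebra on a highest weight vector `Ψ`: `X = x_0^+`,
`x k = x_{k+1}^-`, `η k = h_{k+1}`. -/
structure IsCurrentAction (X : End ℂ V) (x η : ℕ → End ℂ V) (d : ℕ → ℂ) (Ψ : V) : Prop where
  comm : ∀ i j, x i * x j = x j * x i
  raise_lower : ∀ i, X * x i = x i * X + η i
  cartan_lower : ∀ i j, η i * x j = x j * η i - 2 • x (i + j + 1)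
  raise_vec : X Ψ = 0
  cartan_vec : ∀ i, η i Ψ = d i • Ψ

/-- The coefficients of the power series `p` with `p' = -d p` and constant coefficient `1`. -/
def expCoeff (d : ℕ → ℂ) : ℕ → ℂ
  | 0 => 1
  | n + 1 => -((n : ℂ) + 1)⁻¹ * ∑ i : Fin (n + 1), d (n - i) * expCoeff d i

lemma expCoeff_succ (d : ℕ → ℂ) (n : ℕ) :
    ((n : ℂ) + 1) * expCoeff d (n + 1) =
      -∑ q ∈ Finset.HasAntidiagonal.antidiagonal n, d q.1 * expCoeff d q.2 := by
  have hn : (n : ℂ) + 1 ≠ 0 := by exact_mod_cast n.succ_ne_zero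
  rw [expCoeff, Finset.Nat.antidiagonal_eq_map', Finset.sum_map,
    Fin.sum_univ_eq_sum_range (fun i => d (n - i) * expCoeff d i) (n + 1)]
  field_simp
  rfl

/-- Scalar power series as series of operators. -/
def scalarSeries (V : Type*) [AddCommGroup V] [Module ℂ V] (p : ℕ → ℂ) :
    PowerSeries (End ℂ V) :=
  PowerSeries.mk fun n => algebraMap ℂ (End ℂ V) (p n)

namespace IsCurrentAction

variable {X : End ℂ V} {x η : ℕ → End ℂ V} {d : ℕ → ℂ} {Ψ : V}

lemma C_mul_mk (A : IsCurrentAction X x η d Ψ) :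
    PowerSeries.C X * PowerSeries.mk x =
      PowerSeries.mk x * PowerSeries.C X + PowerSeries.mk η := by
  ext1 n
  simp [PowerSeries.coeff_C_mul, PowerSeries.coeff_mul_C, A.raise_lower]

/-- In degree `n` each of the `n + 1` pairs `i + j = n` contributes the same commutator `-2 x (n +
1)`, so the commutator series is `-2 x'(u)`. -/
lemma mk_mul_mk (A : IsCurrentAction X x η d Ψ) :
    PowerSeries.mk η * PowerSeries.mk x =
      PowerSeries.mk x * PowerSeries.mk η - 2 • formalDeriv (PowerSeries.mk x) := by
  ext1 n
  rw [map_sub, map_nsmul, coeff_formalDeriv, PowerSeries.coeff_mul, PowerSeries.coeff_mul,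
    ← Finset.Nat.sum_antidiagonal_swap]
  simp only [PowerSeries.coeff_mk, Prod.fst_swap, Prod.snd_swap, A.cartan_lower,
    Finset.sum_sub_distrib]
  congr 1
  rw [Finset.sum_congr rfl (g := fun _ => 2 • x (n + 1))]
  · rw [Finset.sum_const, Finset.Nat.card_antidiagonal, smul_comm]
  · intro q hq
    rw [add_comm q.2 q.1, Finset.HasAntidiagonal.mem_antidiagonal.mp hq]

lemma mk_mul_formalDeriv (A : IsCurrentAction X x η d Ψ) :
    PowerSeries.mk x * formalDeriv (PowerSeries.mk x) =
      formalDeriv (PowerSeries.mk x) * PowerSeries.mk x := by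
  ext1 n
  rw [PowerSeries.coeff_mul, PowerSeries.coeff_mul, ← Finset.Nat.sum_antidiagonal_swap]
  refine Finset.sum_congr rfl fun q _ => ?_
  simp only [coeff_formalDeriv, PowerSeries.coeff_mk, Prod.fst_swap, Prod.snd_swap,
    mul_smul_comm, smul_mul_assoc, A.comm q.2]

/-- The series `(∑ x_{k+1}^- u^k)^l p(u)`. -/
def lowered (x : ℕ → End ℂ V) (d : ℕ → ℂ) (l : ℕ) : PowerSeries (End ℂ V) :=
  PowerSeries.mk x ^ l * scalarSeries V (expCoeff d)

lemma lowered_succ (l : ℕ) : lowered x d (l + 1) = PowerSeries.mk x * lowered x d l := by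
  rw [lowered, lowered, pow_succ', mul_assoc]

/-- On `Ψ` the series `η(u)` acts as `d(u)`, and `p' = -d p`. -/
lemma cartan_lowered_zero (A : IsCurrentAction X x η d Ψ) :
    PowerSeries.mk η * lowered x d 0 + formalDeriv (lowered x d 0) ∈ seriesAnnihilator Ψ := by
  intro n
  rw [lowered, pow_zero, one_mul, map_add, coeff_formalDeriv, PowerSeries.coeff_mul]
  simp only [scalarSeries, PowerSeries.coeff_mk, LinearMap.add_apply, LinearMap.sum_apply,
    End.mul_apply, Module.algebraMap_end_apply, LinearMap.smul_apply, map_smul, A.cartan_vec,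
    ← Nat.cast_smul_eq_nsmul ℂ, smul_smul, ← Finset.sum_smul, ← add_smul]
  push_cast
  rw [expCoeff_succ]
  simp [mul_comm]

/-- Each further factor `x(u)` costs `-2x'` when `η` moves past it and gains `x'` from the Leibniz
rule. The net defect `-x'` accumulates `l + 1` times, as `x` and `x'` commute. -/
lemma cartan_lowered (A : IsCurrentAction X x η d Ψ) (l : ℕ) :
    PowerSeries.mk η * lowered x d (l + 1) + formalDeriv (lowered x d (l + 1)) +
      (l + 1) • (formalDeriv (PowerSeries.mk x) * lowered x d l) ∈ seriesAnnihilator Ψ := by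
  induction l with
  | zero =>
    convert (seriesAnnihilator Ψ).smul_mem (PowerSeries.mk x) A.cartan_lowered_zero using 1
    rw [smul_eq_mul, lowered_succ, formalDeriv_mul, ← mul_assoc, A.mk_mul_mk]
    simp only [mul_add, sub_mul, smul_mul_assoc, mul_assoc]
    module
  | succ l ih =>
    convert (seriesAnnihilator Ψ).smul_mem (PowerSeries.mk x) ih using 1
    rw [smul_eq_mul, lowered_succ (l + 1), formalDeriv_mul, ← mul_assoc, A.mk_mul_mk]
    simp only [mul_add, sub_mul, smul_mul_assoc, mul_smul_comm]
    rw [← mul_assoc _ (formalDeriv (PowerSeries.mk x)), A.mk_mul_formalDeriv, mul_assoc,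
      mul_assoc, ← lowered_succ]
    module

/-- The recursion behind Garland's identity: moving `x_0^+` past one `x(u)` creates `η(u)`, which
`cartan_lowered` converts into a derivative. -/
lemma raise_lowered (A : IsCurrentAction X x η d Ψ) (l : ℕ) :
    PowerSeries.C X * lowered x d (l + 1) + (l + 1) • formalDeriv (lowered x d l) ∈
      seriesAnnihilator Ψ := by
  induction l with
  | zero =>
    have h1 : PowerSeries.C X * lowered x d 0 ∈ seriesAnnihilator Ψ := by
      intro n
      rw [lowered, pow_zero, one_mul, PowerSeries.coeff_C_mul]
      simp [scalarSeries, A.raise_vec]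
    convert (seriesAnnihilator Ψ).add_mem
      ((seriesAnnihilator Ψ).smul_mem (PowerSeries.mk x) h1) A.cartan_lowered_zero using 1
    rw [smul_eq_mul, lowered_succ, ← mul_assoc, A.C_mul_mk, add_mul, mul_assoc]
    module
  | succ l ih =>
    convert (seriesAnnihilator Ψ).add_mem
      ((seriesAnnihilator Ψ).smul_mem (PowerSeries.mk x) ih) (A.cartan_lowered l) using 1
    rw [smul_eq_mul, lowered_succ (l + 1), ← mul_assoc, A.C_mul_mk, add_mul, mul_assoc, mul_add]
    have h1 : formalDeriv (lowered x d (l + 1)) =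
        formalDeriv (PowerSeries.mk x) * lowered x d l +
          PowerSeries.mk x * formalDeriv (lowered x d l) := by
      rw [lowered_succ, formalDeriv_mul]
    rw [h1]
    simp only [mul_smul_comm]
    module

/-- Garland's identity: the action of `(x_0^+)^n (x_1^-)^(n + l)` on a highest weight vector. -/
theorem raise_pow_lower_pow (A : IsCurrentAction X x η d Ψ) (n l : ℕ) :
    (l.factorial : ℂ) • (X ^ n * x 0 ^ (n + l)) Ψ =
      ((n + l).factorial * n.factorial * (-1) ^ n : ℂ) •
        PowerSeries.coeff n (lowered x d l) Ψ := by
  induction n generalizing l with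
  | zero =>
    have h1 : PowerSeries.coeff 0 (lowered x d l) = x 0 ^ l := by
      rw [lowered, PowerSeries.coeff_zero_eq_constantCoeff, map_mul, map_pow]
      simp [scalarSeries, expCoeff, ← PowerSeries.coeff_zero_eq_constantCoeff_apply]
    simp [h1]
  | succ n ih =>
    -- Trade one lowering for one raising: apply `x_0^+` to the case `(n, l + 1)`. The surplus
    -- factor `l + 1` from `(l + 1)!` is cancelled below.
    have h1 := congrArg X (ih (l + 1))
    have h2 := A.raise_lowered l n
    rw [map_add, LinearMap.add_apply, PowerSeries.coeff_C_mul, End.mul_apply,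
      map_nsmul, coeff_formalDeriv] at h2
    rw [map_smul, map_smul, eq_neg_of_add_eq_zero_left h2, ← End.mul_apply, ← mul_assoc,
      ← pow_succ', ← add_assoc, Nat.add_right_comm n l 1] at h1
    have hl : ((l : ℂ) + 1) ≠ 0 := by exact_mod_cast l.succ_ne_zero
    refine smul_right_injective V hl ?_
    simp only [smul_smul]
    rw [Nat.factorial_succ l] at h1
    push_cast at h1
    rw [h1, LinearMap.smul_apply, LinearMap.smul_apply, ← Nat.cast_smul_eq_nsmul ℂ,
      ← Nat.cast_smul_eq_nsmul ℂ, Nat.factorial_succ n]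
    push_cast
    module

lemma raise_pow_lower_pow_self (A : IsCurrentAction X x η d Ψ) (n : ℕ) :
    (X ^ n * x 0 ^ n) Ψ = (n.factorial * n.factorial * ((-1) ^ n * expCoeff d n) : ℂ) • Ψ := by
  have := A.raise_pow_lower_pow n 0
  simpa [lowered, scalarSeries, smul_smul, mul_assoc] using this

end IsCurrentAction

end Garland

/-! ### Logarithmic derivatives and power sums. -/

section PowerSeriesODE

open PowerSeries

lemma derivative_mk_expCoeff (d : ℕ → ℂ) :
    PowerSeries.derivative ℂ (mk (expCoeff d)) = -(mk d * mk (expCoeff d)) := by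
  ext n
  rw [coeff_derivative, map_neg, coeff_mul]
  simp only [coeff_mk]
  rw [mul_comm, expCoeff_succ]

lemma mk_pow_mul_one_sub (c : ℂ) : (mk fun k => c ^ k) * (1 - C c * X) = 1 := by
  ext n
  cases n with
  | zero => simp [mul_sub]
  | succ n =>
    rw [mul_sub, mul_one, map_sub, mul_left_comm, coeff_C_mul, coeff_succ_mul_X]
    simp [coeff_one, pow_succ']

/-- The logarithmic derivative of `∏ (1 - a_i u) ^ m_i`. -/
lemma derivative_prod_one_sub {ι : Type*} (S : Finset ι) (a : ι → ℂ) (m : ι → ℕ) :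
    PowerSeries.derivative ℂ (∏ i ∈ S, (1 - C (a i) * X) ^ m i) =
      -((mk fun k => ∑ i ∈ S, m i * a i ^ (k + 1)) * ∏ i ∈ S, (1 - C (a i) * X) ^ m i) := by
  classical
  induction S using Finset.induction_on with
  | empty =>
    have : (mk fun _ : ℕ => (0 : ℂ)) = 0 := by
      ext; simp
    simp [this]
  | insert i S hi ih =>
    have h1 : (mk fun k => ∑ j ∈ insert i S, (m j : ℂ) * a j ^ (k + 1)) =
        C (m i * a i : ℂ) * (mk fun k => a i ^ k) +
          mk fun k => ∑ j ∈ S, (m j : ℂ) * a j ^ (k + 1) := by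
      ext k
      rw [map_add, coeff_C_mul, coeff_mk, coeff_mk, coeff_mk, Finset.sum_insert hi]
      ring
    rw [Finset.prod_insert hi, Derivation.leibniz, ih, h1]
    have h2 : PowerSeries.derivative ℂ ((1 - C (a i) * X) ^ m i) =
        -(C (m i * a i : ℂ) * (mk fun k => a i ^ k) * (1 - C (a i) * X) ^ m i) := by
      rcases Nat.eq_zero_or_pos (m i) with h0 | h0
      · simp [h0]
      · obtain ⟨n, hn⟩ := Nat.exists_eq_succ_of_ne_zero h0.ne'
        have h3 := mk_pow_mul_one_sub (a i)
        have h4 : PowerSeries.derivative ℂ (1 - C (a i) * X) = -C (a i) := by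
          rw [map_sub, Derivation.leibniz]
          simp
        rw [derivative_pow, h4, hn]
        simp only [Nat.succ_eq_add_one, Nat.add_sub_cancel, pow_succ _ n, map_mul,
          Nat.cast_succ, map_add, map_one, map_natCast]
        linear_combination (((n : PowerSeries ℂ) + 1) * C (a i) * (1 - C (a i) * X) ^ n) * h3
    rw [h2, smul_eq_mul, smul_eq_mul]
    ring

/-- The weights are the power sums of the reciprocal roots. -/
theorem weight_eq_sum_pow {s : ℕ} {a : Fin s → ℂ} {m : Fin s → ℕ} {d : ℕ → ℂ}
    (h : mk (expCoeff d) = ∏ i, (1 - C (a i) * X) ^ m i) (k : ℕ) :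
    d k = ∑ i, m i * a i ^ (k + 1) := by
  have h1 := derivative_mk_expCoeff d
  rw [h, derivative_prod_one_sub, neg_inj, ← h] at h1
  -- The constant coefficient is 1, so the series can be cancelled from the two expressions for its
  -- derivative.
  have h0 : (mk (expCoeff d) : PowerSeries ℂ) ≠ 0 := by
    intro h0
    have := congrArg (coeff 0) h0
    simp [expCoeff] at this
  have h2 := congrArg (coeff k) (mul_right_cancel₀ h0 h1)
  simpa using h2.symm

end PowerSeriesODE
open Polynomial

/-! ### Operators indexed by polynomials. -/

section Polynomials

variable {M : Type*} [AddCommGroup M] [Module ℂ M]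

/-- The linear map `∑ c_k X ^ k ↦ ∑ c_k g_k`. -/
def polyMap (g : ℕ → M) : ℂ[X] →ₗ[ℂ] M :=
  Polynomial.lsum fun k => LinearMap.toSpanSingleton ℂ M (g k)

@[simp] lemma polyMap_X_pow (g : ℕ → M) (k : ℕ) : polyMap g (X ^ k) = g k := by
  simp [polyMap, Polynomial.lsum_apply, ← Polynomial.monomial_one_right_eq_X_pow,
    Polynomial.sum_monomial_index]

lemma polynomial_linear_induction {P : ℂ[X] → Prop} (add : ∀ p q, P p → P q → P (p + q))
    (smul : ∀ (c : ℂ) p, P p → P (c • p)) (pow : ∀ n, P (X ^ n)) (p : ℂ[X]) : P p := by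
  induction p using Polynomial.induction_on' with
  | add p q hp hq => exact add p q hp hq
  | monomial n c =>
    rw [← mul_one c, ← smul_eq_mul, ← Polynomial.smul_monomial,
      Polynomial.monomial_one_right_eq_X_pow]
    exact smul c _ (pow n)

/-- Both sides are bilinear, so monomials suffice. The shift `N` absorbs the differing index
conventions of the three families. -/
lemma polyMap_mul_polyMap {R : Type*} [Ring R] [Algebra ℂ R] {f g k : ℕ → R} {c : ℂ} {N : ℕ}
    (h : ∀ i j, f i * g j = g j * f i + c • k (i + j + N)) (p q : ℂ[X]) :
    polyMap f p * polyMap g q = polyMap g q * polyMap f p + c • polyMap k (X ^ N * (p * q)) := by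
  induction p using polynomial_linear_induction with
  | add p p' hp hp' =>
    simp only [map_add, add_mul, mul_add, hp, hp', smul_add]
    abel
  | smul b p hp =>
    simp only [map_smul, smul_mul_assoc, mul_smul_comm, hp, smul_add, smul_comm c b]
  | pow i =>
    induction q using polynomial_linear_induction with
    | add p p' hp hp' =>
      simp only [map_add, add_mul, mul_add, hp, hp', smul_add]
      abel
    | smul b p hp =>
      simp only [map_smul, smul_mul_assoc, mul_smul_comm, hp, smul_add, smul_comm c b]
    | pow j => rw [← pow_add, ← pow_add, polyMap_X_pow, polyMap_X_pow, polyMap_X_pow, h, add_comm N]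

lemma prod_X_sub_C_dvd {s : ℕ} {a : Fin s → ℂ} (ha : Function.Injective a) {p : ℂ[X]}
    (hp : ∀ i, p.eval (a i) = 0) : (∏ i, (X - C (a i))) ∣ p :=
  Finset.prod_dvd_of_coprime
    (fun _ _ _ _ hij => Polynomial.pairwise_coprime_X_sub_C ha hij)
    fun i _ => Polynomial.dvd_iff_isRoot.mpr (hp i)

end Polynomials

/-! ### Commutation relations in `U(B)` in polynomial form. -/

lemma gen_zero (k : ℤ) : gen k 0 = 0 := by
  simpa using gen_smul k 0 0

lemma xP_mul_xMsucc (j k : ℕ) : xP j * xMsucc k = xMsucc k * xP j + hB (j + k + 1) := by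
  apply Subtype.ext
  have h1 := xPlus_xMinus j (k + 1 : ℕ)
  have h2 : ((j + k + 1 : ℕ) : ℤ) = (j : ℤ) + (k + 1 : ℕ) := by push_cast; ring
  change xPlus j * xMinus (k + 1 : ℕ) = xMinus (k + 1 : ℕ) * xPlus j + hGen (j + k + 1 : ℕ)
  rw [h2, ← h1]
  abel

lemma hB_mul_xMsucc (j k : ℕ) :
    hB j * xMsucc k = xMsucc k * hB j + (-2 : ℂ) • xMsucc (j + k) := by
  apply Subtype.ext
  have h1 := hGen_xMinus j (k + 1 : ℕ)
  have h2 : ((j + k + 1 : ℕ) : ℤ) = (j : ℤ) + (k + 1 : ℕ) := by push_cast; ring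
  change hGen j * xMinus (k + 1 : ℕ) =
    xMinus (k + 1 : ℕ) * hGen j + (-2 : ℂ) • xMinus (j + k + 1 : ℕ)
  rw [h2, ← h1]
  abel

lemma hB_mul_xP (j k : ℕ) : hB j * xP k = xP k * hB j + (2 : ℂ) • xP (j + k) := by
  apply Subtype.ext
  have h1 := hGen_xPlus j k
  have h2 : ((j + k : ℕ) : ℤ) = (j : ℤ) + k := by push_cast; ring
  change hGen j * xPlus k = xPlus k * hGen j + (2 : ℂ) • xPlus (j + k : ℕ)
  rw [h2, ← h1]
  abel

lemma xMsucc_mul_comm (j k : ℕ) : xMsucc j * xMsucc k = xMsucc k * xMsucc j := by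
  apply Subtype.ext
  have h1 := gen_commutator (j + 1 : ℕ) (k + 1 : ℕ) f f
  rw [lie_self, gen_zero] at h1
  exact sub_eq_zero.mp h1

lemma hB_mul_comm (j k : ℕ) : hB j * hB k = hB k * hB j := by
  apply Subtype.ext
  have h1 := gen_commutator j k h h
  rw [lie_self, gen_zero] at h1
  exact sub_eq_zero.mp h1

/-- `x^-(t p)`, where `x^-(t ^ k) = x_k^-`. -/
def lowerOp : ℂ[X] →ₗ[ℂ] UB := polyMap xMsucc

/-- `x^+(p)`, where `x^+(t ^ k) = x_k^+`. -/
def raiseOp : ℂ[X] →ₗ[ℂ] UB := polyMap xP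

/-- `h(t p)`, where `h(t ^ k) = h_k`. -/
def cartanOp : ℂ[X] →ₗ[ℂ] UB := polyMap fun k => hB (k + 1)

lemma raiseOp_mul_lowerOp (p q : ℂ[X]) :
    raiseOp p * lowerOp q = lowerOp q * raiseOp p + cartanOp (p * q) := by
  have := polyMap_mul_polyMap (f := xP) (g := xMsucc) (k := fun k => hB (k + 1)) (c := 1)
    (N := 0) (fun i j => by rw [xP_mul_xMsucc, one_smul]) p q
  rwa [one_smul, pow_zero, one_mul] at this

lemma cartanOp_mul_lowerOp (p q : ℂ[X]) :
    cartanOp p * lowerOp q = lowerOp q * cartanOp p + (-2 : ℂ) • lowerOp (X * (p * q)) := by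
  have := polyMap_mul_polyMap (f := fun k => hB (k + 1)) (g := xMsucc) (k := xMsucc) (c := -2)
    (N := 1) (fun i j => by rw [hB_mul_xMsucc, Nat.add_right_comm]) p q
  rwa [pow_one] at this

/-- Covers `h_0` as well, which `cartanOp` does not reach. -/
lemma hB_mul_lowerOp (k : ℕ) (q : ℂ[X]) :
    hB k * lowerOp q = lowerOp q * hB k + (-2 : ℂ) • lowerOp (X ^ k * q) := by
  have := polyMap_mul_polyMap (f := hB) (g := xMsucc) (k := xMsucc) (c := -2)
    (N := 0) (fun i j => by rw [hB_mul_xMsucc]; rfl) (X ^ k) q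
  rwa [pow_zero, one_mul, polyMap_X_pow] at this

lemma lowerOp_mul_comm (p q : ℂ[X]) : lowerOp p * lowerOp q = lowerOp q * lowerOp p := by
  have := polyMap_mul_polyMap (f := xMsucc) (g := xMsucc) (k := xMsucc) (c := 0)
    (N := 0) (fun i j => by rw [xMsucc_mul_comm, zero_smul, add_zero]) p q
  rwa [zero_smul, add_zero] at this

lemma coe_lowerOp (p : ℂ[X]) :
    (lowerOp p : U) = polyMap (fun k : ℕ => xMinus k) (X * p) := by
  induction p using polynomial_linear_induction with
  | add p q hp hq => rw [map_add, mul_add, map_add, ← hp, ← hq]; rfl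
  | smul c p hp => rw [map_smul, mul_smul_comm, map_smul, ← hp]; rfl
  | pow n => rw [← pow_succ', polyMap_X_pow, lowerOp, polyMap_X_pow]; rfl

lemma xMinusParam_eq_polyMap (A : Multiset ℂ) :
    xMinusParam A = polyMap (fun k : ℕ => xMinus k) (A.map fun c => X - C c).prod := by
  rw [Multiset.prod_X_sub_X_eq_sum_esymm, map_sum, xMinusParam]
  refine Finset.sum_congr rfl fun k hk => ?_
  have h1 : (-1 : ℂ[X]) ^ k * (C (A.esymm k) * X ^ (A.card - k)) =
      ((-1 : ℂ) ^ k * A.esymm k) • X ^ (A.card - k) := by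
    rw [Polynomial.smul_eq_C_mul]
    simp [mul_assoc]
  rw [h1, map_smul, polyMap_X_pow, Nat.cast_sub (by simpa [Nat.lt_succ_iff] using hk)]

/-- By Vieta, `x_m^-(A)` is `x^-` of `∏ (t - α)`; the parameter 0 supplies the factor `t` built into
`lowerOp`. -/
lemma xMinusExt_eq_lowerOp {s : ℕ} (a : Fin s → ℂ) :
    xMinusExt (Finset.univ.val.map a) = lowerOp (∏ i, (X - C (a i))) := by
  apply Subtype.ext
  rw [coe_lowerOp]
  change xMinusParam _ = _
  rw [xMinusParam_eq_polyMap, Multiset.map_cons, Multiset.prod_cons, C_0, sub_zero,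
    Multiset.map_map]
  rfl

/-! ### Submodules generated by singular vectors. -/

section Modules

variable {V : Type*} [AddCommGroup V] [Module ℂ V] [Module UB V] [IsScalarTower ℂ UB V]

/-- The action of `U(B)` by linear operators. -/
def act (V : Type*) [AddCommGroup V] [Module ℂ V] [Module UB V] [IsScalarTower ℂ UB V] :
    UB →ₐ[ℂ] End ℂ V := Algebra.lsmul ℂ ℂ V

@[simp] lemma act_apply (u : UB) (v : V) : act V u v = u • v := rfl

lemma smul_mem_of_generators {S : Submodule ℂ V} (h1 : ∀ v ∈ S, hB 0 • v ∈ S)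
    (h2 : ∀ v ∈ S, xP 0 • v ∈ S) (h3 : ∀ v ∈ S, xMsucc 0 • v ∈ S) (u : UB) :
    ∀ v ∈ S, u • v ∈ S := by
  obtain ⟨x, hx⟩ := u
  refine Algebra.adjoin_induction (R := ℂ) (s := {hGen 0, xPlus 0, xMinus 1})
    (p := fun x hx => ∀ v ∈ S, (⟨x, hx⟩ : UB) • v ∈ S) ?_ ?_ ?_ ?_ hx
  · rintro x (rfl | rfl | rfl)
    exacts [h1, h2, h3]
  · intro c v hv
    have : ((algebraMap ℂ UB c) • v) ∈ S := by
      rw [algebraMap_smul]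
      exact S.smul_mem c hv
    exact this
  · intro x y hx hy ihx ihy v hv
    have := S.add_mem (ihx v hv) (ihy v hv)
    rwa [← add_smul] at this
  · intro x y hx hy ihx ihy v hv
    have := ihx _ (ihy v hv)
    rwa [← mul_smul] at this

/-- The smallest subspace that contains `K` and is stable under all `x_k^-`. -/
def lowerClosure (K : Submodule ℂ V) : Submodule ℂ V :=
  sInf {T | K ≤ T ∧ ∀ k, ∀ v ∈ T, xMsucc k • v ∈ T}

lemma le_lowerClosure (K : Submodule ℂ V) : K ≤ lowerClosure K :=
  le_sInf fun _ hT => hT.1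

lemma lowerClosure_le {K T : Submodule ℂ V} (h1 : K ≤ T)
    (h2 : ∀ k, ∀ v ∈ T, xMsucc k • v ∈ T) : lowerClosure K ≤ T :=
  sInf_le ⟨h1, h2⟩

lemma xMsucc_smul_mem_lowerClosure {K : Submodule ℂ V} (k : ℕ) {v : V}
    (hv : v ∈ lowerClosure K) : xMsucc k • v ∈ lowerClosure K := by
  refine Submodule.mem_sInf.mpr fun T hT => hT.2 k v ?_
  exact Submodule.mem_sInf.mp hv T hT

lemma hB_smul_mem_lowerClosure {K : Submodule ℂ V} (hK : ∀ j, ∀ v ∈ K, hB j • v ∈ K) (j : ℕ)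
    {v : V} (hv : v ∈ lowerClosure K) : hB j • v ∈ lowerClosure K := by
  -- Minimality of the closure is applied to its vectors whose images under all `h_j` stay in it;
  -- commuting `h_j` past `x_k^-` only creates another lowering operator.
  have : lowerClosure K ≤
      lowerClosure K ⊓ ⨅ j, (lowerClosure K).comap (act V (hB j)) := by
    refine lowerClosure_le (le_inf (le_lowerClosure K) (le_iInf fun j v hv =>
      le_lowerClosure K (hK j v hv))) fun k v hv => ?_
    simp only [Submodule.mem_inf, Submodule.mem_iInf, Submodule.mem_comap, act_apply] at hv ⊢
    refine ⟨xMsucc_smul_mem_lowerClosure k hv.1, fun j => ?_⟩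
    rw [← mul_smul, hB_mul_xMsucc, add_smul, mul_smul, smul_assoc]
    exact Submodule.add_mem _ (xMsucc_smul_mem_lowerClosure k (hv.2 j))
      (Submodule.smul_mem _ _ (xMsucc_smul_mem_lowerClosure _ hv.1))
  have h1 := (this hv).2
  exact (Submodule.mem_iInf _).mp h1 j

lemma xP_smul_mem_lowerClosure {K : Submodule ℂ V} (hK : ∀ j, ∀ v ∈ K, hB j • v ∈ K)
    (hK' : ∀ j, ∀ v ∈ K, xP j • v = 0) (j : ℕ)
    {v : V} (hv : v ∈ lowerClosure K) : xP j • v ∈ lowerClosure K := by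
  have : lowerClosure K ≤
      lowerClosure K ⊓ (lowerClosure K).comap (act V (xP j)) := by
    refine lowerClosure_le (le_inf (le_lowerClosure K) fun v hv => ?_) fun k v hv => ?_
    · rw [Submodule.mem_comap, act_apply, hK' j v hv]
      exact Submodule.zero_mem _
    simp only [Submodule.mem_inf, Submodule.mem_comap, act_apply] at hv ⊢
    refine ⟨xMsucc_smul_mem_lowerClosure k hv.1, ?_⟩
    rw [← mul_smul, xP_mul_xMsucc, add_smul, mul_smul]
    exact Submodule.add_mem _ (xMsucc_smul_mem_lowerClosure k hv.2)
      (hB_smul_mem_lowerClosure hK _ hv.1)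
  exact (this hv).2

/-- The submodule generated by a space of singular vectors. -/
def singularSubmodule (K : Submodule ℂ V) (hK : ∀ j, ∀ v ∈ K, hB j • v ∈ K)
    (hK' : ∀ j, ∀ v ∈ K, xP j • v = 0) : Submodule UB V :=
  { (lowerClosure K).toAddSubmonoid with
    smul_mem' := fun u v hv => smul_mem_of_generators
      (fun _ hv => hB_smul_mem_lowerClosure hK 0 hv)
      (fun _ hv => xP_smul_mem_lowerClosure hK hK' 0 hv)
      (fun _ hv => xMsucc_smul_mem_lowerClosure 0 hv) u v hv }

lemma mem_singularSubmodule {K : Submodule ℂ V} {hK : ∀ j, ∀ v ∈ K, hB j • v ∈ K}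
    {hK' : ∀ j, ∀ v ∈ K, xP j • v = 0} {v : V} :
    v ∈ singularSubmodule K hK hK' ↔ v ∈ lowerClosure K := Iff.rfl

variable {d : ℕ → ℂ} {Ψ : V}

/-! ### Weights from the Drinfeld polynomial, and the simplicity criterion. -/

namespace IsHighestWeightVector

/-- An induction principle: raising and Cartan operators can be moved to the right onto `Ψ`, so the
lowering operators alone generate `V`. -/
lemma mem_of_lower_stable (hΨ : IsHighestWeightVector d Ψ) (hgen : Submodule.span UB {Ψ} = ⊤)
    {T : Submodule ℂ V} (h1 : Ψ ∈ T) (h2 : ∀ k, ∀ v ∈ T, xMsucc k • v ∈ T) (v : V) : v ∈ T := by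
  have hK : ∀ j, ∀ v ∈ Submodule.span ℂ {Ψ}, hB j • v ∈ Submodule.span ℂ {Ψ} := by
    intro j v hv
    obtain ⟨c, rfl⟩ := Submodule.mem_span_singleton.mp hv
    rw [smul_algebra_smul_comm, hΨ.hB_smul]
    exact Submodule.smul_mem _ _ (Submodule.smul_mem _ _ (Submodule.mem_span_singleton_self Ψ))
  have hK' : ∀ j, ∀ v ∈ Submodule.span ℂ {Ψ}, xP j • v = 0 := by
    intro j v hv
    obtain ⟨c, rfl⟩ := Submodule.mem_span_singleton.mp hv
    rw [smul_algebra_smul_comm, hΨ.xP_smul, smul_zero]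
  have h3 : v ∈ singularSubmodule _ hK hK' := by
    have : Submodule.span UB {Ψ} ≤ singularSubmodule _ hK hK' :=
      Submodule.span_le.mpr (Set.singleton_subset_iff.mpr
        (le_lowerClosure _ (Submodule.mem_span_singleton_self Ψ)))
    rw [hgen] at this
    exact this Submodule.mem_top
  exact lowerClosure_le (by simpa using h1) h2 h3

lemma isCurrentAction (hΨ : IsHighestWeightVector d Ψ) :
    IsCurrentAction (act V (xP 0)) (fun k => act V (xMsucc k)) (fun k => act V (hB (k + 1)))
      (fun k => d (k + 1)) Ψ where
  comm i j := by rw [← map_mul, ← map_mul, xMsucc_mul_comm]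
  raise_lower i := by rw [← map_mul, ← map_mul, ← map_add, xP_mul_xMsucc, zero_add]
  cartan_lower i j := by
    rw [← map_mul, ← map_mul, hB_mul_xMsucc, map_add, map_smul, sub_eq_add_neg,
      Nat.add_right_comm, neg_smul, ofNat_smul_eq_nsmul]
  raise_vec := hΨ.xP_smul 0
  cartan_vec i := hΨ.hB_smul (i + 1)

lemma eigenvalue_eq (hΨ : IsHighestWeightVector d Ψ) (n : ℕ) :
    eigenvalue n Ψ = (-1) ^ n * expCoeff (fun k => d (k + 1)) n := by
  have h1 := dividedProduct_smul hΨ n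
  have h2 := hΨ.isCurrentAction.raise_pow_lower_pow_self n
  rw [← map_pow, ← map_pow, ← map_mul, act_apply] at h2
  rw [dividedProduct, smul_mul_smul_comm, smul_assoc, h2, smul_smul] at h1
  have h3 := smul_left_injective ℂ hΨ.ne_zero h1
  have hn : (n.factorial : ℂ) ≠ 0 := by exact_mod_cast n.factorial_ne_zero
  rw [← h3]
  field_simp

lemma expCoeff_eq_zero (hΨ : IsHighestWeightVector d Ψ) {r : ℕ} (hr : IsNilpotentOfDegree r Ψ)
    {n : ℕ} (hn : r < n) : expCoeff (fun k => d (k + 1)) n = 0 := by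
  have h2 := hΨ.isCurrentAction.raise_pow_lower_pow_self n
  obtain ⟨k, rfl⟩ := Nat.exists_eq_add_of_lt hn
  rw [← map_pow, ← map_pow, ← map_mul, act_apply, mul_smul, show r + k + 1 = k + (r + 1) by ring,
    pow_add (xMsucc 0), mul_smul, hr.1, smul_zero, smul_zero, eq_comm,
    smul_eq_zero_iff_left hΨ.ne_zero] at h2
  have hf : ((k + (r + 1)).factorial : ℂ) ≠ 0 := by
    exact_mod_cast (k + (r + 1)).factorial_ne_zero
  simpa [hf, show r + k + 1 = k + (r + 1) by ring] using h2

/-- Nilpotency kills the coefficients beyond `r`, so the truncated sum `P_Ψ` is already the whole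
solution of `p' = -d p`. -/
lemma mk_expCoeff_eq (hΨ : IsHighestWeightVector d Ψ) {r : ℕ} (hr : IsNilpotentOfDegree r Ψ) :
    PowerSeries.mk (expCoeff fun k => d (k + 1)) = (drinfeldPoly r Ψ : PowerSeries ℂ) := by
  ext n
  have h1 : ∀ k, C (eigenvalue k Ψ) * (-X : ℂ[X]) ^ k =
      C (expCoeff (fun k => d (k + 1)) k) * X ^ k := by
    intro k
    have h2 : ((-1 : ℂ) ^ k) * (-1) ^ k = 1 := by rw [← mul_pow]; simp
    have h3 : (-X : ℂ[X]) ^ k = C ((-1) ^ k) * X ^ k := by rw [neg_pow]; simp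
    rw [hΨ.eigenvalue_eq, h3, ← mul_assoc, ← C_mul, mul_right_comm, h2, one_mul]
  rw [PowerSeries.coeff_mk, Polynomial.coeff_coe, drinfeldPoly]
  simp only [h1, Polynomial.finsetSum_coeff, Polynomial.coeff_C_mul_X_pow,
    Finset.sum_ite_eq, Finset.mem_range]
  split_ifs with hn
  · rfl
  · exact hΨ.expCoeff_eq_zero hr (by omega)

lemma weight_eq (hΨ : IsHighestWeightVector d Ψ) {r : ℕ} (hr : IsNilpotentOfDegree r Ψ)
    {s : ℕ} {a : Fin s → ℂ} {m : Fin s → ℕ} (ham : IsEvaluationParameters r Ψ a m) (k : ℕ) :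
    d (k + 1) = ∑ i, m i * a i ^ (k + 1) := by
  refine weight_eq_sum_pow (d := fun k => d (k + 1)) ?_ k
  rw [hΨ.mk_expCoeff_eq hr, ham.factorization]
  rw [← Polynomial.coeToPowerSeries.ringHom_apply, map_prod]
  simp

lemma cartanOp_smul (hΨ : IsHighestWeightVector d Ψ) (p : ℂ[X]) :
    cartanOp p • Ψ = polyMap (fun k => d (k + 1)) p • Ψ := by
  induction p using polynomial_linear_induction with
  | add p q hp hq => rw [map_add, map_add, add_smul, add_smul, hp, hq]
  | smul c p hp => rw [map_smul, map_smul, smul_assoc, smul_assoc, hp]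
  | pow n => rw [cartanOp, polyMap_X_pow, polyMap_X_pow, hΨ.hB_smul]

lemma raiseOp_smul (hΨ : IsHighestWeightVector d Ψ) (p : ℂ[X]) : raiseOp p • Ψ = 0 := by
  induction p using polynomial_linear_induction with
  | add p q hp hq => rw [map_add, add_smul, hp, hq, add_zero]
  | smul c p hp => rw [map_smul, smul_assoc, hp, smul_zero]
  | pow n => rw [raiseOp, polyMap_X_pow, hΨ.xP_smul]

/-- In a simple module, a singular vector one step below the highest weight vector vanishes. -/
lemma eq_zero_of_singular (hΨ : IsHighestWeightVector d Ψ) [IsSimpleModule UB V] {w : V}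
    (h1 : hB 0 • w = (d 0 - 2) • w) (h2 : ∀ k, xP k • w = 0) : w = 0 := by
  by_contra hw
  -- All singular vectors of this weight are taken, not just the line of `w`, since `w` need not be
  -- an eigenvector of every `h_j`.
  set K : Submodule ℂ V := End.eigenspace (act V (hB 0)) (d 0 - 2) ⊓
    ⨅ k, LinearMap.ker (act V (xP k)) with hKdef
  have hmem : ∀ v, v ∈ K ↔ hB 0 • v = (d 0 - 2) • v ∧ ∀ k, xP k • v = 0 := by
    intro v
    simp [hKdef]
  have hK : ∀ j, ∀ v ∈ K, hB j • v ∈ K := by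
    intro j v hv
    rw [hmem] at hv ⊢
    refine ⟨?_, fun k => ?_⟩
    · rw [← mul_smul, hB_mul_comm, mul_smul, hv.1, smul_algebra_smul_comm]
    · have h3 := congrArg (· • v) (hB_mul_xP j k)
      simp only [add_smul, mul_smul, smul_assoc, hv.2, smul_zero, add_zero] at h3
      exact h3.symm
  have hK' : ∀ j, ∀ v ∈ K, xP j • v = 0 := fun j v hv => ((hmem v).mp hv).2 j
  have htop : singularSubmodule K hK hK' = ⊤ := by
    refine (eq_bot_or_eq_top _).resolve_left fun hbot => hw ?_
    have : w ∈ singularSubmodule K hK hK' := le_lowerClosure K ((hmem w).mpr ⟨h1, h2⟩)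
    rwa [hbot, Submodule.mem_bot] at this
  have hΨmem : Ψ ∈ lowerClosure K := by
    rw [← mem_singularSubmodule (hK := hK) (hK' := hK'), htop]
    exact Submodule.mem_top
  -- Lowering from weight `d 0 - 2` never returns to `d 0`, the weight of `Ψ`; independence of
  -- eigenspaces then gives the contradiction.
  have hle : lowerClosure K ≤ ⨆ n : ℕ, End.eigenspace (act V (hB 0)) (d 0 - 2 * (n + 1)) := by
    refine lowerClosure_le (fun v hv => ?_) fun k v hv => ?_
    · refine Submodule.mem_iSup_of_mem 0 ?_
      simpa [End.mem_eigenspace_iff] using ((hmem v).mp hv).1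
    · refine Submodule.iSup_induction _
        (motive := fun v => xMsucc k • v ∈
          ⨆ n : ℕ, End.eigenspace (act V (hB 0)) (d 0 - 2 * (n + 1))) hv ?_ ?_ ?_
      · intro n v hv
        refine Submodule.mem_iSup_of_mem (n + 1) ?_
        rw [End.mem_eigenspace_iff, act_apply] at hv ⊢
        rw [← mul_smul, hB_mul_xMsucc, add_smul, mul_smul, hv,
          smul_comm (xMsucc k) (_ : ℂ),
          zero_add, smul_assoc]
        generalize xMsucc k • v = y
        push_cast
        module
      · rw [smul_zero]
        exact Submodule.zero_mem _
      · intro x y hx hy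
        rw [smul_add]
        exact Submodule.add_mem _ hx hy
  have hle' : (⨆ n : ℕ, End.eigenspace (act V (hB 0)) (d 0 - 2 * (n + 1))) ≤
      ⨆ (c : ℂ) (_ : c ≠ d 0), End.eigenspace (act V (hB 0)) c := by
    refine iSup_le fun n => le_iSup₂_of_le (d 0 - 2 * (n + 1)) ?_ le_rfl
    have : (n : ℂ) + 1 ≠ 0 := by exact_mod_cast n.succ_ne_zero
    simpa [sub_eq_self] using this
  have hdisj := (End.eigenspaces_iSupIndep (act V (hB 0))) (d 0)
  refine hΨ.ne_zero (Submodule.disjoint_def.mp hdisj Ψ ?_ (hle' (hle hΨmem)))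
  exact End.mem_eigenspace_iff.mpr (hΨ.hB_smul 0)

/-- A lowering operator that kills `Ψ` generates an ideal of lowering operators killing the whole
module. -/
lemma lowerOp_mul_smul (hΨ : IsHighestWeightVector d Ψ) (hgen : Submodule.span UB {Ψ} = ⊤)
    {q : ℂ[X]} (hq : lowerOp q • Ψ = 0) (p : ℂ[X]) (v : V) : lowerOp (p * q) • v = 0 := by
  have h1 : lowerOp (p * q) • Ψ = 0 := by
    induction p using polynomial_linear_induction with
    | add p p' hp hp' => rw [add_mul, map_add, add_smul, hp, hp', add_zero]
    | smul c p hp => rw [smul_mul_assoc, map_smul, smul_assoc, hp, smul_zero]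
    | pow k =>
      -- The commutator of `h_k` with `x^-(t q)` is `-2 x^-(t^{k+1} q)`, and both products kill `Ψ`.
      have h2 := congrArg (· • Ψ) (hB_mul_lowerOp k q)
      simp only [add_smul, mul_smul, smul_assoc, hΨ.hB_smul, hq, smul_zero] at h2
      rw [smul_algebra_smul_comm, hq, smul_zero, zero_add, eq_comm] at h2
      exact (smul_eq_zero.mp h2).resolve_left (by norm_num)
  refine hΨ.mem_of_lower_stable hgen (T := LinearMap.ker (act V (lowerOp (p * q)))) h1
    (fun k v hv => ?_) v
  rw [LinearMap.mem_ker, act_apply] at hv ⊢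
  have h3 := lowerOp_mul_comm (p * q) (X ^ k)
  rw [show lowerOp (X ^ k) = xMsucc k from polyMap_X_pow _ _] at h3
  rw [← mul_smul, h3, mul_smul, hv, smul_zero]

/-- `h(t p q)` is the commutator of `x_0^+` with `x^-(t p q)`, which already vanishes on `V`. -/
lemma cartanOp_mul_smul (hΨ : IsHighestWeightVector d Ψ) (hgen : Submodule.span UB {Ψ} = ⊤)
    {q : ℂ[X]} (hq : lowerOp q • Ψ = 0) (p : ℂ[X]) (v : V) : cartanOp (p * q) • v = 0 := by
  have h1 := congrArg (· • v) (raiseOp_mul_lowerOp 1 (p * q))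
  simp only [add_smul, mul_smul, hΨ.lowerOp_mul_smul hgen hq, smul_zero, zero_add,
    one_mul] at h1
  exact h1.symm

variable {s : ℕ} {a : Fin s → ℂ}

/-- If the extended lowering operator kills `Ψ`, then the module is simple. -/
theorem isSimpleModule [FiniteDimensional ℂ V] (hΨ : IsHighestWeightVector d Ψ)
    (hgen : Submodule.span UB {Ψ} = ⊤) (hinj : Function.Injective a) (ha : ∀ j, a j ≠ 0)
    (hq : lowerOp (∏ i, (X - C (a i))) • Ψ = 0) : IsSimpleModule UB V := by
  have hlow : ∀ p p' : ℂ[X], (∀ i, p.eval (a i) = p'.eval (a i)) →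
      ∀ v : V, lowerOp p • v = lowerOp p' • v := by
    intro p p' hp v
    obtain ⟨b, hb⟩ := prod_X_sub_C_dvd hinj (p := p - p') (by simpa [sub_eq_zero] using hp)
    rw [← sub_eq_zero, ← sub_smul, ← map_sub, hb, mul_comm]
    exact hΨ.lowerOp_mul_smul hgen hq b v
  have hcar : ∀ p p' : ℂ[X], (∀ i, p.eval (a i) = p'.eval (a i)) →
      ∀ v : V, cartanOp p • v = cartanOp p' • v := by
    intro p p' hp v
    obtain ⟨b, hb⟩ := prod_X_sub_C_dvd hinj (p := p - p') (by simpa [sub_eq_zero] using hp)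
    rw [← sub_eq_zero, ← sub_smul, ← map_sub, hb, mul_comm]
    exact hΨ.cartanOp_mul_smul hgen hq b v
  -- Normalized so that `t M_j`, the loop carried by `lowerOp (M j)` and `cartanOp (M j)`, takes the
  -- value `δ_ij` at `a_i`.
  set M : Fin s → ℂ[X] := fun j => C (a j)⁻¹ * Lagrange.basis Finset.univ a j with hMdef
  have hM : ∀ i j, (M j).eval (a i) = if i = j then (a j)⁻¹ else 0 := by
    intro i j
    rw [hMdef]
    simp only [eval_mul, eval_C]
    split_ifs with hij
    · subst hij
      rw [Lagrange.eval_basis_self hinj.injOn (Finset.mem_univ _), mul_one]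
    · rw [Lagrange.eval_basis_of_ne (Ne.symm hij) (Finset.mem_univ _), mul_zero]
  have hMM : ∀ i j k, (X * (M i * M j)).eval (a k) = (if i = j then M i else 0).eval (a k) := by
    intro i j k
    rw [eval_mul, eval_mul, eval_X, hM, hM]
    by_cases hij : i = j
    · subst hij
      rw [if_pos rfl, hM]
      by_cases hk : k = i
      · subst hk
        have := ha k
        simp only [if_true]
        field_simp
      · simp [hk]
    · rw [if_neg hij, eval_zero]
      by_cases hk : k = i
      · subst hk; simp [hij]
      · simp [hk]
  -- `raiseOp` has no built-in factor `t`, hence the explicit `X`. The relations follow from `X M_i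
  -- M_j ≡ δ_ij M_i` modulo `Q`.
  have T : IsCommutingTriples (fun j => act V (raiseOp (X * M j))) (fun j => act V (lowerOp (M j)))
      (fun j => act V (cartanOp (M j))) Ψ (fun j => polyMap (fun k => d (k + 1)) (M j)) :=
    { commute_F := fun i j _ => by
        change act V _ * act V _ = act V _ * act V _
        rw [← map_mul, lowerOp_mul_comm, map_mul]
      E_F := fun i j v => by
        simp only [act_apply]
        rw [← mul_smul, raiseOp_mul_lowerOp, add_smul, mul_smul, mul_assoc,
          hcar _ _ (hMM i j)]
        split_ifs <;> simp
      H_F := fun i j v => by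
        simp only [act_apply]
        rw [← mul_smul, cartanOp_mul_lowerOp, add_smul, mul_smul, smul_assoc,
          hlow _ _ (hMM i j)]
        split_ifs <;> simp [sub_eq_add_neg]
      E_vec := fun i => hΨ.raiseOp_smul _
      H_vec := fun i => hΨ.cartanOp_smul _ }
  have hspan : ∀ v : V, v ∈ Submodule.span ℂ (Set.range (monomialVec _ T.commute_F Ψ)) := by
    refine hΨ.mem_of_lower_stable hgen (Submodule.subset_span ⟨0, monomialVec_zero⟩) ?_
    intro k v hv
    -- Interpolation of `t^k` at the nodes: `M_j` has value `a_j⁻¹` at `a_j`, so the coefficient is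
    -- `a_j^{k+1}`.
    have h1 : xMsucc k • v = ∑ j, (a j * a j ^ k) • lowerOp (M j) • v := by
      have h2 := hlow (X ^ k) (∑ j, (a j * a j ^ k) • M j) (fun i => by
        have := ha i
        simp [eval_finsetSum, hM]
        field_simp) v
      rw [show lowerOp (X ^ k) = xMsucc k from polyMap_X_pow _ _] at h2
      rw [h2, map_sum, Finset.sum_smul]
      simp only [map_smul, smul_assoc]
    rw [h1]
    refine Submodule.sum_mem _ fun j _ => Submodule.smul_mem _ _ ?_
    have h3 : Submodule.span ℂ (Set.range (monomialVec _ T.commute_F Ψ)) ≤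
        (Submodule.span ℂ (Set.range (monomialVec _ T.commute_F Ψ))).comap
          (act V (lowerOp (M j))) := by
      rw [Submodule.span_le]
      rintro _ ⟨n, rfl⟩
      refine Submodule.subset_span ⟨n + Pi.single j 1, ?_⟩
      rw [monomialVec_add_single, pow_one]
    exact h3 hv
  rw [isSimpleModule_iff]
  have : Nontrivial V := ⟨Ψ, 0, hΨ.ne_zero⟩
  refine { eq_bot_or_eq_top := fun N => or_iff_not_imp_left.mpr fun hN => ?_ }
  obtain ⟨w, hw, hw0⟩ := N.ne_bot_iff.mp hN
  obtain ⟨A, hA, hAw⟩ := T.exists_raise_eq hΨ.ne_zero hw0 (hspan w)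
  have hstab : ∀ v ∈ N, A v ∈ N := by
    clear hAw
    induction hA using Algebra.adjoin_induction with
    | mem x hx =>
      obtain ⟨j, rfl⟩ := hx
      exact fun v hv => N.smul_mem _ hv
    | algebraMap c =>
      exact fun v hv => (N.restrictScalars ℂ).smul_mem c hv
    | add x y _ _ hx hy => exact fun v hv => N.add_mem (hx v hv) (hy v hv)
    | mul x y _ _ hx hy => exact fun v hv => hx _ (hy v hv)
  rw [eq_top_iff, ← hgen, Submodule.span_le, Set.singleton_subset_iff, ← hAw]
  exact hstab w hw

/-- In a simple module, the extended lowering operator kills `Ψ`. -/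
theorem lowerOp_prod_smul_eq_zero (hΨ : IsHighestWeightVector d Ψ) [IsSimpleModule UB V] {r : ℕ}
    (hr : IsNilpotentOfDegree r Ψ) {m : Fin s → ℕ} (ham : IsEvaluationParameters r Ψ a m) :
    lowerOp (∏ i, (X - C (a i))) • Ψ = 0 := by
  have hd : ∀ p : ℂ[X], polyMap (fun k => d (k + 1)) p = ∑ i, m i * a i * p.eval (a i) := by
    intro p
    induction p using polynomial_linear_induction with
    | add p q hp hq => simp only [map_add, hp, hq, eval_add, mul_add, Finset.sum_add_distrib]
    | smul c p hp =>
      rw [map_smul, hp, smul_eq_mul, Finset.mul_sum]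
      exact Finset.sum_congr rfl fun i _ => by rw [eval_smul, smul_eq_mul]; ring
    | pow n =>
      rw [polyMap_X_pow, hΨ.weight_eq hr ham]
      exact Finset.sum_congr rfl fun i _ => by rw [eval_pow, eval_X]; ring
  refine hΨ.eq_zero_of_singular ?_ fun k => ?_
  · rw [← mul_smul, hB_mul_lowerOp, add_smul, mul_smul, hΨ.hB_smul,
      smul_comm _ (d 0), smul_assoc, pow_zero, one_mul]
    generalize lowerOp (∏ i, (X - C (a i))) • Ψ = y
    module
  · have h1 := raiseOp_mul_lowerOp (X ^ k) (∏ i, (X - C (a i)))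
    rw [show raiseOp (X ^ k) = xP k from polyMap_X_pow _ _] at h1
    rw [← mul_smul, h1, add_smul, mul_smul, hΨ.xP_smul, smul_zero, zero_add, hΨ.cartanOp_smul,
      hd, Finset.sum_eq_zero, zero_smul]
    intro i _
    rw [eval_mul, eval_prod, Finset.prod_eq_zero (Finset.mem_univ i) (by simp), mul_zero,
      mul_zero]

end IsHighestWeightVector

end Modules
end LoopSL2
end

theorem mainTheorem2 {V : Type*} [AddCommGroup V] [Module ℂ V] [Module LoopSL2.UB V]
    [IsScalarTower ℂ LoopSL2.UB V] [FiniteDimensional ℂ V]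
    (d : ℕ → ℂ) (Ψ : V) (hΨ : LoopSL2.IsHighestWeightVector d Ψ)
    (hgen : Submodule.span LoopSL2.UB {Ψ} = ⊤)
    (r : ℕ) (hr : LoopSL2.IsNilpotentOfDegree r Ψ)
    (s : ℕ) (a : Fin s → ℂ) (m : Fin s → ℕ)
    (ham : LoopSL2.IsEvaluationParameters r Ψ a m)
    (ha : ∀ j, a j ≠ 0) :
    IsSimpleModule LoopSL2.UB V ↔
      LoopSL2.xMinusExt (Finset.univ.val.map a) • Ψ = 0 := by
  rw [LoopSL2.xMinusExt_eq_lowerOp]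
  exact ⟨fun _ => hΨ.lowerOp_prod_smul_eq_zero hr ham,
    fun hq => hΨ.isSimpleModule hgen ham.distinct ha hq⟩
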